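/- **Conventions.** Let $T_n$ ($n\in\mathbb Z$) be the Chebyshev polynomials: $T_0=1$, $T_1=t$, $T_{n+1}=2tT_n-T_{n-1}$ (so $T_{-n}=T_n$). For pairwise coprime integers $a,b,c$ the harmonic knot $H(a,b,c)$ is the curve $x=T_a(t)$, $y=T_b(t)$, $z=T_c(t)$, $t\in\mathbb R$, together with the point at infinity, in $S^3=\mathbb R^3\cup\{\infty\}$. Knots are unoriented subsets of $S^3$, considered up to ambient isotopy of $S^3$; the mirror image of a knot is its image under $(x,y,z)\mapsto(x,y,-z)$, extended by $\infty\mapsto\infty$. A crossing of the $(x,y)$-diagram of $H(a,b,c)$ is given by parameters $t\neq s$ with $T_a(t)=T_a(s)$ and $T_b(t)=T_b(s)$; its sign is the sign of $D=(T_c(t)-T_c(s))\,T_a'(t)\,T_b'(t)$. **Proposition.** Let $a,b,c$ be pairwise coprime integers. 1. There is an integer $c'$, coprime to $a$ and to $b$, such that $H(a,b,c')$ is the mirror image of $H(a,b,c)$. 2. More precisely, whenever $c=\alpha a+\beta b$ with integers $\alpha,\beta$, the integer $c'=-\alpha a+\beta b$ is coprime to $a$ and to $b$; at every crossing the sign for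 $H(a,b,c)$ is nonzero and the sign for $H(a,b,c')$ is its opposite; and $H(a,b,c')$ is the mirror image of $H(a,b,c)$. **Consequences.** 3. For all coprime integers $a,b$, the knot $H(a,b,ab+a-b)$ is the mirror image of $H(a,b,ab-a-b)$. 4. For all nonzero coprime integers $a,b$, the knots $H(a,b,c)$, with $c$ ranging over all integers coprime to both $a$ and $b$, represent at most $\varphi(|a|)\,\varphi(|b|)$ different knots (ambient isotopy classes), where $\varphi$ is Euler's function. -/

import Mathlib

namespace HarmonicKnot

open Topology

/-- The three-sphere, as the one-point compactification of `ℝ³`. -/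
abbrev S3 : Type := OnePoint (ℝ × ℝ × ℝ)

/-- The value at `t` of the Chebyshev polynomial `T_n`, for any integer `n`
(`T_0 = 1`, `T_1 = t`, `T_{n+1} = 2 t T_n - T_{n-1}`, so that `T_{-n} = T_n`). -/
noncomputable def cheb (n : ℤ) (t : ℝ) : ℝ := (Polynomial.Chebyshev.T ℝ n).eval t

/-- The parametrized harmonic curve `x = T_a(t), y = T_b(t), z = T_c(t)` in `ℝ³`. -/
noncomputable def curve (a b c : ℤ) (t : ℝ) : ℝ × ℝ × ℝ := (cheb a t, cheb b t, cheb c t)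

/-- The harmonic knot `H(a,b,c)` in the three-sphere: the harmonic curve together with the point
at infinity. It is a knot when `a`, `b`, `c` are pairwise coprime. -/
noncomputable def harmonic (a b c : ℤ) : Set S3 :=
  insert OnePoint.infty (Set.range fun t : ℝ => ((curve a b c t : ℝ × ℝ × ℝ) : S3))

/-- The reflection `(x, y, z) ↦ (x, y, -z)`, extended to the three-sphere. -/
noncomputable def reflection : S3 ≃ₜ S3 :=
  Homeomorph.onePointCongr
    ((Homeomorph.refl ℝ).prodCongr ((Homeomorph.refl ℝ).prodCongr (Homeomorph.neg ℝ)))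

/-- The mirror image of a subset of the three-sphere. -/
noncomputable def mirror (K : Set S3) : Set S3 := reflection '' K

/-- Two subsets of the three-sphere are the same knot if an ambient isotopy of the three-sphere
carries the first to the second. -/
def AmbientIsotopic (K L : Set S3) : Prop :=
  ∃ h : unitInterval → (S3 ≃ₜ S3),
    Continuous (fun p : unitInterval × S3 => h p.1 p.2) ∧
    h 0 = Homeomorph.refl S3 ∧ h 1 '' K = L

theorem ambientIsotopic_refl (K : Set S3) : AmbientIsotopic K K :=
  ⟨fun _ => Homeomorph.refl S3, continuous_snd, rfl, by simp⟩

theorem ambientIsotopic_symm {K L : Set S3} (hKL : AmbientIsotopic K L) :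
    AmbientIsotopic L K := by
  obtain ⟨h, hc, h0, h1⟩ := hKL
  refine ⟨fun u => (h 1).symm.trans (h (unitInterval.symm u)), ?_, ?_, ?_⟩
  · exact hc.comp ((unitInterval.continuous_symm.comp continuous_fst).prodMk
      ((h 1).symm.continuous.comp continuous_snd))
  · ext x
    simp
  · subst h1
    ext x
    simp [h0]

theorem ambientIsotopic_trans {K L M : Set S3} (hKL : AmbientIsotopic K L)
    (hLM : AmbientIsotopic L M) : AmbientIsotopic K M := by
  obtain ⟨h, hc, h0, h1⟩ := hKL
  obtain ⟨g, gc, g0, g1⟩ := hLM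
  refine ⟨fun u => (h u).trans (g u), ?_, ?_, ?_⟩
  · exact gc.comp (continuous_fst.prodMk hc)
  · ext x
    simp [h0, g0]
  · subst h1 g1
    rw [Set.image_image]
    rfl

/-- The relation of being the same knot, as an equivalence relation. -/
def knotSetoid : Setoid (Set S3) where
  r := AmbientIsotopic
  iseqv := ⟨ambientIsotopic_refl, ambientIsotopic_symm, ambientIsotopic_trans⟩

/-- Knot types: subsets of the three-sphere up to ambient isotopy. -/
abbrev KnotType : Type := Quotient knotSetoid

/-- The knot type represented by a subset of the three-sphere. -/
def knotType (K : Set S3) : KnotType := Quotient.mk knotSetoid K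

/-- The pair of parameters `(t, s)` gives a double point of the plane curve
`x = T_a(t), y = T_b(t)`. -/
def IsCrossing (a b : ℤ) (t s : ℝ) : Prop :=
  t ≠ s ∧ cheb a t = cheb a s ∧ cheb b t = cheb b s

/-- The sign of `D = (z(t) - z(s)) x'(t) y'(t)`, which gives the nature of the crossing
with parameters `(t, s)` of the `(x,y)`-diagram of `H(a,b,c)`. -/
noncomputable def crossingSign (a b c : ℤ) (t s : ℝ) : SignType :=
  SignType.sign ((cheb c t - cheb c s) * deriv (cheb a) t * deriv (cheb b) t)

end HarmonicKnot

namespace HarmonicKnot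

open Topology Filter

/-! The knot type depends only on the planar curve and on which strand is higher at each crossing:
heights with the same order there are joined by a fibrewise affine isotopy
(`ambientIsotopic_graphKnot`). For c = αa + βb and c' = −αa + βb, the sum T_c + T_c' = 2 T_α(T_a)
T_β(T_b) is a function of the planar point, so every height difference at a crossing changes sign
(`IsCrossing.cheb_sub_reflect`). With t = cos 2πx and s = cos 2πy, a crossing makes a(x − y) and b(x
+ y) integers, after possibly replacing y by −y; coprimality then makes crossings simple with
distinct heights. Moreover T_{2ab} = 1 there, so only ±c mod 2ab matters, which leaves the r < |ab|
coprime to ab: φ(|a|)φ(|b|) values. -/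

/-! ### Vertical isotopies of the three-sphere -/

/-- A jointly continuous family of homeomorphisms, whose inverses are also jointly continuous,
extends continuously to the one-point compactification. -/
theorem continuous_onePointCongr_family {I X : Type*} [TopologicalSpace I] [CompactSpace I]
    [TopologicalSpace X] [T2Space X] (h : I → (X ≃ₜ X))
    (hc : Continuous fun p : I × X => h p.1 p.2)
    (hi : Continuous fun p : I × X => (h p.1).symm p.2) :
    Continuous fun p : I × OnePoint X => (h p.1).onePointCongr p.2 := by
  rw [continuous_iff_continuousAt]
  rintro ⟨u, x⟩
  induction x using OnePoint.rec with
  | infty =>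
    refine (((𝓝 u).basis_sets.prod_nhds OnePoint.hasBasis_nhds_infty).tendsto_iff
      OnePoint.hasBasis_nhds_infty).2 ?_
    rintro K ⟨-, hK⟩
    -- Compactness of the parameter space keeps the union of all preimages of `K` compact; its
    -- complement is the required neighbourhood of infinity.
    have hL : IsCompact ((fun p : I × X => (h p.1).symm p.2) '' (Set.univ ×ˢ K)) :=
      (isCompact_univ.prod hK).image hi
    refine ⟨(Set.univ, _), ⟨univ_mem, hL.isClosed, hL⟩, ?_⟩
    rintro ⟨v, y⟩ ⟨-, hy⟩
    induction y using OnePoint.rec with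
    | infty => right; rfl
    | coe y =>
      left
      refine ⟨h v y, fun hmem => ?_, rfl⟩
      rcases hy with ⟨y', hy', he⟩ | hy
      · rw [OnePoint.coe_injective he] at hy'
        exact hy' ⟨(v, h v y), ⟨trivial, hmem⟩, by simp⟩
      · exact OnePoint.coe_ne_infty _ hy
  | coe x =>
    have he : IsOpenEmbedding (Prod.map id ((↑) : X → OnePoint X) : I × X → I × OnePoint X) :=
      IsOpenEmbedding.id.prodMap OnePoint.isOpenEmbedding_coe
    have := (he.continuousAt_iff (g := fun p : I × OnePoint X => (h p.1).onePointCongr p.2)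
      (x := (u, x))).1 ((OnePoint.continuous_coe.comp hc).continuousAt)
    exact this

/-- The curve with planar projection `γ` and height `z`, together with the point at infinity. -/
def graphKnot (γ : ℝ → ℝ × ℝ) (z : ℝ → ℝ) : Set S3 :=
  insert OnePoint.infty (Set.range fun t : ℝ => ((((γ t).1, (γ t).2, z t) : ℝ × ℝ × ℝ) : S3))

/-- The fibrewise affine homeomorphism `(p, z) ↦ (p, m p * z + k p)`. -/
noncomputable def affineShear (m k : ℝ × ℝ → ℝ) (hm : Continuous m) (hk : Continuous k)
    (hpos : ∀ p, 0 < m p) : (ℝ × ℝ × ℝ) ≃ₜ (ℝ × ℝ × ℝ) where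
  toFun q := (q.1, q.2.1, m (q.1, q.2.1) * q.2.2 + k (q.1, q.2.1))
  invFun q := (q.1, q.2.1, (q.2.2 - k (q.1, q.2.1)) / m (q.1, q.2.1))
  left_inv q := by
    have := (hpos (q.1, q.2.1)).ne'
    ext <;> simp
    field_simp
  right_inv q := by
    have := (hpos (q.1, q.2.1)).ne'
    ext <;> simp
    field_simp
    ring
  continuous_toFun := by fun_prop
  continuous_invFun := by
    have : ∀ q : ℝ × ℝ × ℝ, m (q.1, q.2.1) ≠ 0 := fun q => (hpos _).ne'
    fun_prop (disch := assumption)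

/-- Interpolate linearly from the identity to the shear; the vertical factor stays positive, being a
convex combination of 1 and `m p`. -/
theorem ambientIsotopic_graphKnot_of_affine {γ : ℝ → ℝ × ℝ} {z w : ℝ → ℝ} {m k : ℝ × ℝ → ℝ}
    (hm : Continuous m) (hk : Continuous k) (hpos : ∀ p, 0 < m p)
    (hw : ∀ t, w t = m (γ t) * z t + k (γ t)) :
    AmbientIsotopic (graphKnot γ z) (graphKnot γ w) := by
  have hpos' : ∀ (u : unitInterval) (p : ℝ × ℝ), 0 < (1 - (u : ℝ)) + u * m p := by
    intro u p
    rcases u.2.2.lt_or_eq with h | h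
    · have := mul_nonneg u.2.1 (hpos p).le
      linarith
    · rw [h]
      simpa using hpos p
  let h : unitInterval → (ℝ × ℝ × ℝ) ≃ₜ (ℝ × ℝ × ℝ) := fun u =>
    affineShear (fun p => (1 - (u : ℝ)) + u * m p) (fun p => u * k p)
      (by fun_prop) (by fun_prop) (hpos' u)
  refine ⟨fun u => (h u).onePointCongr, continuous_onePointCongr_family h ?_ ?_, ?_, ?_⟩
  · simp only [h, affineShear, Homeomorph.homeomorph_mk_coe, Equiv.coe_fn_mk]
    fun_prop
  · simp only [h, affineShear, Homeomorph.homeomorph_mk_coe_symm, Equiv.coe_fn_symm_mk]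
    have : ∀ q : unitInterval × ℝ × ℝ × ℝ,
        (1 - (q.1 : ℝ)) + q.1 * m (q.2.1, q.2.2.1) ≠ 0 := fun q => (hpos' _ _).ne'
    fun_prop (disch := assumption)
  · ext x
    induction x using OnePoint.rec with
    | infty => rfl
    | coe x => simp [h, affineShear]
  · rw [graphKnot, Set.image_insert_eq, ← Set.range_comp, graphKnot]
    congr 2
    funext t
    simp [h, affineShear, hw]

/-- Two heights over a closed planar curve give isotopic knots if they differ, up to a positive
factor depending on the planar point, by a function that is constant on the fibres. -/
theorem ambientIsotopic_graphKnot_of_scale {γ : ℝ → ℝ × ℝ} {z w : ℝ → ℝ} {m : ℝ × ℝ → ℝ}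
    (hγ : Continuous γ) (hγc : IsClosedMap γ) (hz : Continuous z) (hw : Continuous w)
    (hm : Continuous m) (hpos : ∀ p, 0 < m p)
    (h : ∀ t s, γ t = γ s → w t - m (γ t) * z t = w s - m (γ s) * z s) :
    AmbientIsotopic (graphKnot γ z) (graphKnot γ w) := by
  have hq : IsQuotientMap (Set.rangeFactorization γ) :=
    IsClosedMap.isQuotientMap
      (IsClosedMap.codRestrict hγc _) (by fun_prop) Set.rangeFactorization_surjective
  let ψ : C(ℝ, ℝ) := ⟨fun t => w t - m (γ t) * z t, by fun_prop⟩
  have hψ : Function.FactorsThrough ψ (Set.rangeFactorization γ) :=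
    fun t s hts => h t s (congrArg Subtype.val hts)
  let φ : C(Set.range γ, ℝ) := IsQuotientMap.lift (f := ⟨_, hq.continuous⟩) hq ψ hψ
  have hφ : ∀ t, φ ⟨γ t, t, rfl⟩ = ψ t := fun t =>
    congrArg (fun f : C(ℝ, ℝ) => f t) (IsQuotientMap.lift_comp (f := ⟨_, hq.continuous⟩) hq ψ hψ)
  -- Tietze extension from the closed image of the curve.
  obtain ⟨k, hk⟩ := ContinuousMap.exists_restrict_eq hγc.isClosed_range φ
  refine ambientIsotopic_graphKnot_of_affine hm k.continuous hpos fun t => ?_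
  have : k (γ t) = ψ t := by rw [← hφ t, ← hk]; rfl
  rw [this]
  simp [ψ]

/-- Two heights over a closed planar curve with finitely many double points, all of them simple,
give isotopic knots if they order the two strands at each double point in the same way. -/
theorem ambientIsotopic_graphKnot {γ : ℝ → ℝ × ℝ} {z w : ℝ → ℝ}
    (hγ : Continuous γ) (hγc : IsClosedMap γ) (hz : Continuous z) (hw : Continuous w)
    (hfin : {p | ∃ t s, t ≠ s ∧ γ t = p ∧ γ s = p}.Finite)
    (htwo : ∀ t s r, t ≠ s → γ t = γ s → γ t = γ r → r = t ∨ r = s)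
    (hsign : ∀ t s, t ≠ s → γ t = γ s → 0 < (z t - z s) * (w t - w s)) :
    AmbientIsotopic (graphKnot γ z) (graphKnot γ w) := by
  set P : Set (ℝ × ℝ) := {p | ∃ t s, t ≠ s ∧ γ t = p ∧ γ s = p} with hP
  -- The ratio is recorded by its logarithm, so that after a Tietze extension from the finite set
  -- `P` the exponential is positive everywhere.
  have hex : ∀ p : P, ∃ r : ℝ, ∀ t s, γ t = p → γ s = p →
      w t - w s = Real.exp r * (z t - z s) := by
    rintro ⟨p, t₀, s₀, hne, ht₀, hs₀⟩
    have h0 := hsign t₀ s₀ hne (ht₀.trans hs₀.symm)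
    have hz0 : z t₀ - z s₀ ≠ 0 := left_ne_zero_of_mul h0.ne'
    have hq : 0 < (w t₀ - w s₀) / (z t₀ - z s₀) := by
      rw [div_pos_iff]
      rcases pos_and_pos_or_neg_and_neg_of_mul_pos h0 with h | h
      · exact Or.inl h.symm
      · exact Or.inr h.symm
    refine ⟨Real.log ((w t₀ - w s₀) / (z t₀ - z s₀)), fun t s ht hs => ?_⟩
    rw [Real.exp_log hq]
    rcases htwo t₀ s₀ t hne (ht₀.trans hs₀.symm) (ht₀.trans ht.symm) with rfl | rfl <;>
    rcases htwo _ _ s hne (ht₀.trans hs₀.symm) (ht₀.trans hs.symm) with rfl | rfl <;>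
    field_simp <;> ring
  choose r hr using hex
  have : Finite P := hfin
  obtain ⟨g, hg⟩ := ContinuousMap.exists_restrict_eq hfin.isClosed
    (⟨r, continuous_of_discreteTopology⟩ : C(P, ℝ))
  refine ambientIsotopic_graphKnot_of_scale (m := fun p => Real.exp (g p)) hγ hγc hz hw
    (by fun_prop) (fun p => Real.exp_pos _) fun t s hts => ?_
  by_cases hne : t = s
  · rw [hne]
  have hp : γ t ∈ P := ⟨t, s, hne, rfl, hts.symm⟩
  have h1 : g (γ t) = r ⟨γ t, hp⟩ :=
    congrArg (fun f : C(P, ℝ) => f ⟨γ t, hp⟩) hg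
  have h2 := hr ⟨γ t, hp⟩ t s rfl hts.symm
  rw [← hts]
  simp only [h1]
  linarith

/-! ### Angles and Chebyshev values at crossings -/

theorem cos_two_pi_mul_eq_iff {x y : ℂ} :
    Complex.cos (2 * Real.pi * x) = Complex.cos (2 * Real.pi * y) ↔
      ∃ k : ℤ, y = k + x ∨ y = k - x := by
  have hpi : (2 * Real.pi : ℂ) ≠ 0 := by simp [Real.pi_ne_zero]
  rw [Complex.cos_eq_cos_iff]
  refine exists_congr fun k => or_congr ?_ ?_ <;> constructor <;> intro h
  · exact mul_left_cancel₀ hpi (by linear_combination h)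
  · linear_combination 2 * Real.pi * h
  · exact mul_left_cancel₀ hpi (by linear_combination h)
  · linear_combination 2 * Real.pi * h

/-- Complex angles cover parameters outside [−1, 1] as well. -/
theorem exists_cos_two_pi_mul (t : ℝ) : ∃ x : ℂ, Complex.cos (2 * Real.pi * x) = t := by
  have hpi : (2 * Real.pi : ℂ) ≠ 0 := by simp [Real.pi_ne_zero]
  obtain ⟨y, hy⟩ := Complex.cos_surjective t
  exact ⟨y / (2 * Real.pi), by rw [mul_div_cancel₀ _ hpi, hy]⟩

theorem ofReal_cheb {t : ℝ} {x : ℂ} (hx : Complex.cos (2 * Real.pi * x) = t) (n : ℤ) :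
    (cheb n t : ℂ) = Complex.cos (2 * Real.pi * (n * x)) := by
  rw [cheb, Polynomial.Chebyshev.complex_ofReal_eval_T, ← hx,
    Polynomial.Chebyshev.T_complex_cos]
  ring_nf

theorem cheb_eq_cheb_iff {t s : ℝ} {x y : ℂ} (hx : Complex.cos (2 * Real.pi * x) = t)
    (hy : Complex.cos (2 * Real.pi * y) = s) (n : ℤ) :
    cheb n t = cheb n s ↔ ∃ k : ℤ, n * y = k + n * x ∨ n * y = k - n * x := by
  rw [← cos_two_pi_mul_eq_iff, ← ofReal_cheb hx, ← ofReal_cheb hy, Complex.ofReal_inj]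

theorem eq_intCast_of_mul_eq {a b : ℤ} (hab : IsCoprime a b) {d : ℂ} {k l : ℤ}
    (hk : a * d = k) (hl : b * d = l) : ∃ n : ℤ, d = n := by
  obtain ⟨u, v, huv⟩ := hab
  have h : (u * a + v * b : ℂ) = 1 := by exact_mod_cast huv
  exact ⟨u * k + v * l, by push_cast; linear_combination (-d) * h + u * hk + v * hl⟩

theorem eq_of_sub_eq_intCast {t s : ℝ} {x y : ℂ} (hx : Complex.cos (2 * Real.pi * x) = t)
    (hy : Complex.cos (2 * Real.pi * y) = s) {a b : ℤ} (hab : IsCoprime a b) {k l : ℤ}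
    (hk : a * (x - y) = k) (hl : b * (x - y) = l) : t = s := by
  obtain ⟨n, hn⟩ := eq_intCast_of_mul_eq hab hk hl
  have : Complex.cos (2 * Real.pi * x) = Complex.cos (2 * Real.pi * y) :=
    cos_two_pi_mul_eq_iff.2 ⟨-n, Or.inl (by push_cast; linear_combination -hn)⟩
  rw [hx, hy] at this
  exact_mod_cast this

theorem eq_of_add_eq_intCast {t s : ℝ} {x y : ℂ} (hx : Complex.cos (2 * Real.pi * x) = t)
    (hy : Complex.cos (2 * Real.pi * y) = s) {a b : ℤ} (hab : IsCoprime a b) {k l : ℤ}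
    (hk : a * (x + y) = k) (hl : b * (x + y) = l) : t = s :=
  eq_of_sub_eq_intCast (y := -y) hx (by rw [mul_neg, Complex.cos_neg, hy]) hab
    (by rw [sub_neg_eq_add, hk]) (by rw [sub_neg_eq_add, hl])

/-- The angles of the two parameters of a crossing. -/
theorem IsCrossing.exists_angle {a b : ℤ} (hab : IsCoprime a b) {t s : ℝ}
    (h : IsCrossing a b t s) {x : ℂ} (hx : Complex.cos (2 * Real.pi * x) = t) :
    ∃ y : ℂ, Complex.cos (2 * Real.pi * y) = s ∧
      ∃ k l : ℤ, a * (x - y) = k ∧ b * (x + y) = l := by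
  obtain ⟨hne, ha, hb⟩ := h
  obtain ⟨y, hy⟩ := exists_cos_two_pi_mul s
  obtain ⟨k, hk⟩ := (cheb_eq_cheb_iff hx hy a).1 ha
  obtain ⟨l, hl⟩ := (cheb_eq_cheb_iff hx hy b).1 hb
  rcases hk with hk | hk <;> rcases hl with hl | hl
  · exact absurd (eq_of_sub_eq_intCast (k := -k) (l := -l) hx hy hab
      (by push_cast; linear_combination -hk) (by push_cast; linear_combination -hl)) hne
  · exact ⟨y, hy, -k, l, by push_cast; linear_combination -hk, by linear_combination hl⟩
  · exact ⟨-y, by rw [mul_neg, Complex.cos_neg, hy], k, -l, by linear_combination hk,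
      by push_cast; linear_combination -hl⟩
  · exact absurd (eq_of_add_eq_intCast (k := k) (l := l) hx hy hab
      (by linear_combination hk) (by linear_combination hl)) hne

theorem IsCrossing.symm {a b : ℤ} {t s : ℝ} (h : IsCrossing a b t s) : IsCrossing a b s t :=
  ⟨h.1.symm, h.2.1.symm, h.2.2.symm⟩

theorem IsCrossing.swap {a b : ℤ} {t s : ℝ} (h : IsCrossing a b t s) : IsCrossing b a t s :=
  ⟨h.1, h.2.2, h.2.1⟩

/-- The crossings of the planar curve are simple double points. -/
theorem IsCrossing.eq_of_isCrossing {a b : ℤ} (hab : IsCoprime a b) {t s r : ℝ}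
    (hs : IsCrossing a b t s) (hr : IsCrossing a b t r) : s = r := by
  obtain ⟨x, hx⟩ := exists_cos_two_pi_mul t
  obtain ⟨y, hy, k, l, hk, hl⟩ := hs.exists_angle hab hx
  obtain ⟨y', hy', k', l', hk', hl'⟩ := hr.exists_angle hab hx
  exact eq_of_sub_eq_intCast (k := k' - k) (l := l - l') hy hy' hab
    (by push_cast; linear_combination hk' - hk) (by push_cast; linear_combination hl - hl')

/-- The strands have different heights at a crossing. -/
theorem IsCrossing.cheb_ne {a b c : ℤ} (hab : IsCoprime a b) (hac : IsCoprime a c)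
    (hbc : IsCoprime b c) {t s : ℝ} (h : IsCrossing a b t s) : cheb c t ≠ cheb c s := by
  intro hc
  obtain ⟨x, hx⟩ := exists_cos_two_pi_mul t
  obtain ⟨y, hy, k, l, hk, hl⟩ := h.exists_angle hab hx
  obtain ⟨m, hm | hm⟩ := (cheb_eq_cheb_iff hx hy c).1 hc
  · exact h.1 (eq_of_sub_eq_intCast (l := -m) hx hy hac hk
      (by push_cast; linear_combination -hm))
  · exact h.1 (eq_of_add_eq_intCast (l := m) hx hy hbc hl (by linear_combination hm))

/-- The parameter of a crossing has the form `cos (k * π / (a * b))`. -/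
theorem IsCrossing.cheb_two_mul_eq_one {a b : ℤ} (hab : IsCoprime a b) {t s : ℝ}
    (h : IsCrossing a b t s) : cheb (2 * (a * b)) t = 1 := by
  obtain ⟨x, hx⟩ := exists_cos_two_pi_mul t
  obtain ⟨y, hy, k, l, hk, hl⟩ := h.exists_angle hab hx
  -- 2abx = b·a(x − y) + a·b(x + y).
  have h1 : ((2 * (a * b) : ℤ) : ℂ) * x = (k * b + l * a : ℤ) := by
    push_cast; linear_combination b * hk + a * hl
  have h2 := ofReal_cheb hx (2 * (a * b))
  have h3 : Complex.cos (2 * Real.pi * (0 : ℂ)) =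
      Complex.cos (2 * Real.pi * ((k * b + l * a : ℤ) : ℂ)) :=
    cos_two_pi_mul_eq_iff.2 ⟨k * b + l * a, Or.inl (by simp)⟩
  rw [h1, ← h3] at h2
  simpa using h2

theorem cheb_add_of_cheb_eq_one {t : ℝ} {n : ℤ} (h : cheb n t = 1) (c : ℤ) :
    cheb (c + n) t = cheb c t := by
  obtain ⟨x, hx⟩ := exists_cos_two_pi_mul t
  have h2 := ofReal_cheb hx n
  rw [h] at h2
  have h3 : Complex.cos (2 * Real.pi * (0 : ℂ)) = Complex.cos (2 * Real.pi * (n * x)) := by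
    rw [← h2]; simp
  obtain ⟨k, hk⟩ := cos_two_pi_mul_eq_iff.1 h3
  have hk' : (n : ℂ) * x = k := by simpa using hk
  rw [← Complex.ofReal_inj, ofReal_cheb hx, ofReal_cheb hx]
  exact cos_two_pi_mul_eq_iff.2 ⟨-k, Or.inl (by push_cast; linear_combination -hk')⟩

theorem cheb_continuous (n : ℤ) : Continuous (cheb n) :=
  (Polynomial.Chebyshev.T ℝ n).continuous

theorem deriv_cheb (n : ℤ) (t : ℝ) :
    deriv (cheb n) t = n * (Polynomial.Chebyshev.U ℝ (n - 1)).eval t := by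
  have : cheb n = fun t => (Polynomial.Chebyshev.T ℝ n).eval t := rfl
  rw [this, Polynomial.deriv, Polynomial.Chebyshev.T_derivative_eq_U]
  simp

/-- A zero derivative forces sin(2πax) = 0, so 2ax is an integer; then a(x + y) = 2ax − a(x − y) is
one too, and with b(x + y) this gives t = s. -/
theorem IsCrossing.deriv_cheb_left_ne_zero {a b : ℤ} (hab : IsCoprime a b) {t s : ℝ}
    (h : IsCrossing a b t s) : deriv (cheb a) t ≠ 0 := by
  intro h0
  rw [deriv_cheb] at h0
  obtain ⟨x, hx⟩ := exists_cos_two_pi_mul t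
  obtain ⟨y, hy, k, l, hk, hl⟩ := h.exists_angle hab hx
  have hsin : Complex.sin (a * (2 * Real.pi * x)) = 0 := by
    rcases mul_eq_zero.1 h0 with h0 | h0
    · have : a = 0 := by exact_mod_cast h0
      simp [this]
    · have h1 := Polynomial.Chebyshev.U_complex_cos (2 * Real.pi * x) (a - 1)
      rw [hx, ← Polynomial.Chebyshev.complex_ofReal_eval_U, h0] at h1
      simpa using h1.symm
  obtain ⟨j, hj⟩ := Complex.sin_eq_zero_iff.1 hsin
  have hpi : (Real.pi : ℂ) ≠ 0 := by simp [Real.pi_ne_zero]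
  have hj' : 2 * a * x = (j : ℂ) := by
    apply mul_right_cancel₀ hpi
    linear_combination hj
  exact h.1 (eq_of_add_eq_intCast (k := j - k) hx hy hab
    (by push_cast; linear_combination hj' - hk) hl)

theorem IsCrossing.deriv_cheb_right_ne_zero {a b : ℤ} (hab : IsCoprime a b) {t s : ℝ}
    (h : IsCrossing a b t s) : deriv (cheb b) t ≠ 0 :=
  h.swap.deriv_cheb_left_ne_zero hab.symm

/-- Reflecting a coefficient of `c` in `a` and `b` changes the sign of the height difference at
each crossing. -/
theorem IsCrossing.cheb_sub_reflect {a b : ℤ} {t s : ℝ} (h : IsCrossing a b t s) (α β : ℤ) :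
    cheb (-α * a + β * b) t - cheb (-α * a + β * b) s =
      -(cheb (α * a + β * b) t - cheb (α * a + β * b) s) := by
  have key : ∀ r : ℝ, cheb (-α * a + β * b) r + cheb (α * a + β * b) r =
      2 * cheb α (cheb a r) * cheb β (cheb b r) := by
    intro r
    have h1 := congrArg (Polynomial.eval r) (Polynomial.Chebyshev.T_mul_T ℝ (β * b) (α * a))
    rw [Polynomial.Chebyshev.T_mul, Polynomial.Chebyshev.T_mul] at h1
    simp only [Polynomial.eval_mul, Polynomial.eval_add, Polynomial.eval_comp,
      Polynomial.eval_ofNat] at h1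
    rw [show -α * a + β * b = β * b - α * a by ring, show α * a + β * b = β * b + α * a by ring]
    unfold cheb
    linear_combination -h1
  have ht := key t
  have hs := key s
  rw [h.2.1, h.2.2] at ht
  linarith

theorem cheb_neg (n : ℤ) : cheb (-n) = cheb n := by
  funext t
  simp [cheb]

theorem tendsto_norm_cheb_atTop {α : Type*} {l : Filter α} {n : ℤ} (hn : n ≠ 0) {f : α → ℝ}
    (hf : Tendsto (fun i => ‖f i‖) l atTop) : Tendsto (fun i => ‖cheb n (f i)‖) l atTop :=
  Polynomial.tendsto_norm_atTop _
    (by rw [Polynomial.Chebyshev.degree_T]; exact_mod_cast Int.natAbs_pos.2 hn) hf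

/-! ### Properness and finitely many double points of the planar curve -/

/-- The planar projection of a harmonic knot. -/
noncomputable def planeCurve (a b : ℤ) (t : ℝ) : ℝ × ℝ := (cheb a t, cheb b t)

theorem planeCurve_continuous (a b : ℤ) : Continuous (planeCurve a b) :=
  (cheb_continuous a).prodMk (cheb_continuous b)

theorem planeCurve_isClosedMap {a b : ℤ} (hab : IsCoprime a b) : IsClosedMap (planeCurve a b) := by
  refine (isProperMap_iff_tendsto_cocompact.2 ⟨planeCurve_continuous a b, ?_⟩).isClosedMap
  rw [← Metric.cobounded_eq_cocompact (α := ℝ × ℝ), ← tendsto_norm_atTop_iff_cobounded]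
  have hid : Tendsto (fun t : ℝ => ‖t‖) (cocompact ℝ) atTop := tendsto_norm_cocompact_atTop
  by_cases ha : a = 0
  · have hb : b ≠ 0 := by
      rintro rfl
      exact not_isUnit_zero (isCoprime_zero_left.1 (ha ▸ hab))
    exact tendsto_atTop_mono (fun t => norm_snd_le (planeCurve a b t))
      (tendsto_norm_cheb_atTop hb hid)
  · exact tendsto_atTop_mono (fun t => norm_fst_le (planeCurve a b t))
      (tendsto_norm_cheb_atTop ha hid)

theorem planeCurve_eq_iff {a b : ℤ} {t s : ℝ} :
    planeCurve a b t = planeCurve a b s ↔ cheb a t = cheb a s ∧ cheb b t = cheb b s :=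
  Prod.mk_inj

theorem not_isCrossing_of_isUnit {a b : ℤ} (hb : IsUnit b) {t s : ℝ} : ¬ IsCrossing a b t s := by
  rintro ⟨hne, -, h⟩
  rcases Int.isUnit_iff.1 hb with rfl | rfl <;> simp [cheb] at h <;> exact hne h

theorem finite_setOf_isCrossing {a b : ℤ} (hab : IsCoprime a b) :
    {t | ∃ s, IsCrossing a b t s}.Finite := by
  -- Here T_{2ab} − 1 vanishes identically, but the other index is ±1 and its coordinate is
  -- injective.
  by_cases h0 : a * b = 0
  · convert Set.finite_empty
    rw [Set.eq_empty_iff_forall_notMem]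
    rintro t ⟨s, h⟩
    rcases mul_eq_zero.1 h0 with rfl | rfl
    · exact not_isCrossing_of_isUnit (isCoprime_zero_left.1 hab) h
    · exact not_isCrossing_of_isUnit (isCoprime_zero_right.1 hab) h.swap
  have hdeg : 0 < (Polynomial.Chebyshev.T ℝ (2 * (a * b))).degree := by
    rw [Polynomial.Chebyshev.degree_T]
    exact_mod_cast Int.natAbs_pos.2 (mul_ne_zero two_ne_zero h0)
  have hne : Polynomial.Chebyshev.T ℝ (2 * (a * b)) - Polynomial.C 1 ≠ 0 := by
    intro h
    rw [sub_eq_zero.1 h] at hdeg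
    simp at hdeg
  refine (Polynomial.finite_setOfPred_isRoot hne).subset ?_
  rintro t ⟨s, h⟩
  have := h.cheb_two_mul_eq_one hab
  simpa [cheb, Polynomial.IsRoot, sub_eq_zero] using this

/-- Two heights that order the strands in the same way at each crossing of the planar curve give
the same knot. -/
theorem ambientIsotopic_graphKnot_planeCurve {a b : ℤ} (hab : IsCoprime a b) {z w : ℝ → ℝ}
    (hz : Continuous z) (hw : Continuous w)
    (hsign : ∀ t s, IsCrossing a b t s → 0 < (z t - z s) * (w t - w s)) :
    AmbientIsotopic (graphKnot (planeCurve a b) z) (graphKnot (planeCurve a b) w) := by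
  have hcr : ∀ {t s}, t ≠ s → planeCurve a b t = planeCurve a b s → IsCrossing a b t s :=
    fun hne h => ⟨hne, planeCurve_eq_iff.1 h⟩
  refine ambientIsotopic_graphKnot (planeCurve_continuous a b) (planeCurve_isClosedMap hab) hz hw
    (((finite_setOf_isCrossing hab).image (planeCurve a b)).subset ?_) ?_
    fun t s hne h => hsign t s (hcr hne h)
  · rintro p ⟨t, s, hne, rfl, hs⟩
    exact ⟨t, ⟨s, hcr hne hs.symm⟩, rfl⟩
  · intro t s r hne hs hr
    by_cases hrt : r = t
    · exact Or.inl hrt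
    · exact Or.inr ((hcr hne hs).eq_of_isCrossing hab (hcr (Ne.symm hrt) hr)).symm

theorem mirror_harmonic (a b c : ℤ) :
    mirror (harmonic a b c) = graphKnot (planeCurve a b) (fun t => -cheb c t) := by
  rw [mirror, harmonic, Set.image_insert_eq, ← Set.range_comp]
  rfl

/-! ### Mirror images and the count of knot types -/

theorem knotType_harmonic_reflect {a b α β : ℤ} (hab : IsCoprime a b)
    (hac : IsCoprime a (α * a + β * b)) (hbc : IsCoprime b (α * a + β * b)) :
    knotType (harmonic a b (-α * a + β * b)) = knotType (mirror (harmonic a b (α * a + β * b))) := by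
  rw [mirror_harmonic]
  refine Quotient.sound (ambientIsotopic_graphKnot_planeCurve hab (cheb_continuous _)
    (cheb_continuous _).neg fun t s h => ?_)
  have h1 := sq_pos_of_ne_zero (sub_ne_zero.2 (h.cheb_ne hab hac hbc))
  rw [h.cheb_sub_reflect]
  linarith

theorem isCoprime_left_reflect {a b α β : ℤ} (hac : IsCoprime a (α * a + β * b)) :
    IsCoprime a (-α * a + β * b) := by
  rw [show -α * a + β * b = α * a + β * b + a * (-2 * α) by ring]
  exact hac.add_mul_left_right _

theorem isCoprime_right_reflect {a b α β : ℤ} (hbc : IsCoprime b (α * a + β * b)) :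
    IsCoprime b (-α * a + β * b) := by
  rw [show -α * a + β * b = -(α * a + β * b) + b * (2 * β) by ring]
  exact hbc.neg_right.add_mul_left_right _

theorem IsCrossing.crossingSign_ne_zero {a b c : ℤ} (hab : IsCoprime a b) (hac : IsCoprime a c)
    (hbc : IsCoprime b c) {t s : ℝ} (h : IsCrossing a b t s) : crossingSign a b c t s ≠ 0 :=
  sign_ne_zero.2 (mul_ne_zero (mul_ne_zero (sub_ne_zero.2 (h.cheb_ne hab hac hbc))
    (h.deriv_cheb_left_ne_zero hab)) (h.deriv_cheb_right_ne_zero hab))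

theorem IsCrossing.crossingSign_reflect {a b : ℤ} {t s : ℝ} (h : IsCrossing a b t s) (α β : ℤ) :
    crossingSign a b (-α * a + β * b) t s = -crossingSign a b (α * a + β * b) t s := by
  rw [crossingSign, crossingSign, h.cheb_sub_reflect, neg_mul, neg_mul, Left.sign_neg]

theorem knotType_harmonic_add_two_mul {a b c : ℤ} (hab : IsCoprime a b) (hac : IsCoprime a c)
    (hbc : IsCoprime b c) (n : ℤ) :
    knotType (harmonic a b (c + n * (2 * (a * b)))) = knotType (harmonic a b c) := by
  refine Quotient.sound (ambientIsotopic_graphKnot_planeCurve hab (cheb_continuous _)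
    (cheb_continuous _) fun t s h => ?_)
  have key : ∀ r r', IsCrossing a b r r' → cheb (c + n * (2 * (a * b))) r = cheb c r := by
    intro r r' hr
    have h1 := hr.cheb_two_mul_eq_one hab
    apply cheb_add_of_cheb_eq_one
    rw [cheb, Polynomial.Chebyshev.T_mul, Polynomial.eval_comp]
    change Polynomial.eval (cheb _ r) _ = 1
    rw [h1, Polynomial.Chebyshev.T_eval_one]
  rw [key t s h, key s t h.symm, ← sq]
  exact sq_pos_of_ne_zero (sub_ne_zero.2 (h.cheb_ne hab hac hbc))

theorem knotType_harmonic_neg (a b c : ℤ) :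
    knotType (harmonic a b (-c)) = knotType (harmonic a b c) := by
  simp only [harmonic, curve, cheb_neg]

/-- Every harmonic knot with planar projection given by `a` and `b` is obtained from a height
`T_r` with `0 ≤ r < |ab|`. -/
theorem exists_lt_knotType_harmonic {a b c : ℤ} (ha : a ≠ 0) (hb : b ≠ 0) (hab : IsCoprime a b)
    (hac : IsCoprime a c) (hbc : IsCoprime b c) :
    ∃ r < (a * b).natAbs, (a * b).natAbs.Coprime r ∧
      knotType (harmonic a b c) = knotType (harmonic a b r) := by
  have h0 : a * b ≠ 0 := mul_ne_zero ha hb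
  -- When |ab| = 1 the only admissible r is 0, possibly not ±c mod 2ab, but there are no crossings
  -- at all.
  by_cases hu : IsUnit (a * b)
  · refine ⟨0, Int.natAbs_pos.2 h0, by simpa using Int.isUnit_iff_natAbs_eq.1 hu, ?_⟩
    exact Quotient.sound (ambientIsotopic_graphKnot_planeCurve hab (cheb_continuous _)
      (cheb_continuous _) fun t s h => absurd h
        (not_isCrossing_of_isUnit (isUnit_of_mul_isUnit_right hu)))
  -- The balanced residue satisfies |d| ≤ |ab|; equality is excluded because d is coprime to the
  -- non-unit ab.
  set d : ℤ := Int.bmod c (2 * (a * b).natAbs) with hd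
  obtain ⟨n, hn⟩ : ∃ n : ℤ, d = c + n * (2 * (a * b)) := by
    have h1 : (2 * (a * b)) ∣ d - c := by
      rw [← Int.natAbs_dvd, Int.natAbs_mul]
      exact (Int.modEq_iff_dvd.1 (Int.ModEq.symm (Int.bmod_emod (x := c) (m := 2 * (a * b).natAbs))))
    obtain ⟨n, hn⟩ := h1
    exact ⟨n, by linear_combination hn⟩
  have hcop : IsCoprime (a * b) d := by
    rw [hn, show c + n * (2 * (a * b)) = c + (a * b) * (2 * n) by ring]
    exact (IsCoprime.mul_left hac hbc).add_mul_left_right _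
  have hcop' : (a * b).natAbs.Coprime d.natAbs := Int.isCoprime_iff_gcd_eq_one.1 hcop
  refine ⟨d.natAbs, ?_, hcop', ?_⟩
  · have hle : d.natAbs ≤ (a * b).natAbs := by
      have hpos : 0 < 2 * (a * b).natAbs := by positivity
      have h1 := Int.bmod_lt (x := c) hpos
      have h2 := Int.le_bmod (x := c) hpos
      omega
    refine lt_of_le_of_ne hle fun he => hu ?_
    rw [he, Nat.coprime_self] at hcop'
    exact Int.isUnit_iff_natAbs_eq.2 hcop'
  · rw [← knotType_harmonic_add_two_mul hab hac hbc n, ← hn]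
    rcases Int.natAbs_eq d with h | h
    · rw [← h]
    · conv_lhs => rw [h, knotType_harmonic_neg]

theorem encard_harmonic_le {a b : ℤ} (ha : a ≠ 0) (hb : b ≠ 0) (hab : IsCoprime a b) :
    {κ : KnotType | ∃ c : ℤ, IsCoprime a c ∧ IsCoprime b c ∧
      κ = knotType (harmonic a b c)}.encard ≤
        ((Nat.totient a.natAbs * Nat.totient b.natAbs : ℕ) : ℕ∞) := by
  rw [← Nat.totient_mul (Int.isCoprime_iff_gcd_eq_one.1 hab), ← Int.natAbs_mul,
    Nat.totient_eq_card_coprime, ← Set.encard_coe_eq_coe_finsetCard]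
  refine (Set.encard_le_encard ?_).trans
    (Set.encard_image_le (fun r : ℕ => knotType (harmonic a b r)) _)
  rintro κ ⟨c, hac, hbc, rfl⟩
  obtain ⟨r, hr, hcop, he⟩ := exists_lt_knotType_harmonic ha hb hab hac hbc
  exact ⟨r, Finset.mem_coe.2 (Finset.mem_filter.2 ⟨Finset.mem_range.2 hr, hcop⟩), he.symm⟩

end HarmonicKnot

theorem mainTheorem9 :
    (∀ a b c : ℤ, IsCoprime a b → IsCoprime a c → IsCoprime b c →
      (∃ c' : ℤ, IsCoprime a c' ∧ IsCoprime b c' ∧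
        HarmonicKnot.knotType (HarmonicKnot.harmonic a b c') =
          HarmonicKnot.knotType (HarmonicKnot.mirror (HarmonicKnot.harmonic a b c))) ∧
      (∀ α β c' : ℤ, c = α * a + β * b → c' = -α * a + β * b →
        IsCoprime a c' ∧ IsCoprime b c' ∧
        (∀ t s : ℝ, HarmonicKnot.IsCrossing a b t s →
          HarmonicKnot.crossingSign a b c t s ≠ 0 ∧
          HarmonicKnot.crossingSign a b c' t s = -HarmonicKnot.crossingSign a b c t s) ∧
        HarmonicKnot.knotType (HarmonicKnot.harmonic a b c') =
          HarmonicKnot.knotType (HarmonicKnot.mirror (HarmonicKnot.harmonic a b c)))) ∧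
    (∀ a b : ℤ, IsCoprime a b →
      HarmonicKnot.knotType (HarmonicKnot.harmonic a b (a * b + a - b)) =
        HarmonicKnot.knotType
          (HarmonicKnot.mirror (HarmonicKnot.harmonic a b (a * b - a - b)))) ∧
    (∀ a b : ℤ, a ≠ 0 → b ≠ 0 → IsCoprime a b →
      {κ : HarmonicKnot.KnotType | ∃ c : ℤ, IsCoprime a c ∧ IsCoprime b c ∧
          κ = HarmonicKnot.knotType (HarmonicKnot.harmonic a b c)}.encard ≤
        ((Nat.totient a.natAbs * Nat.totient b.natAbs : ℕ) : ℕ∞)) := by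
  refine ⟨fun a b c hab hac hbc => ⟨?_, ?_⟩, fun a b hab => ?_,
    fun a b ha hb hab => HarmonicKnot.encard_harmonic_le ha hb hab⟩
  · obtain ⟨u, v, huv⟩ := hab
    -- Bézout's relation scaled by c supplies α and β.
    have hc : c = c * u * a + c * v * b := by linear_combination (-c) * huv
    rw [hc] at hac hbc ⊢
    exact ⟨_, HarmonicKnot.isCoprime_left_reflect hac, HarmonicKnot.isCoprime_right_reflect hbc,
      HarmonicKnot.knotType_harmonic_reflect ⟨u, v, huv⟩ hac hbc⟩
  · rintro α β _ rfl rfl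
    exact ⟨HarmonicKnot.isCoprime_left_reflect hac, HarmonicKnot.isCoprime_right_reflect hbc,
      fun t s h => ⟨h.crossingSign_ne_zero hab hac hbc, h.crossingSign_reflect α β⟩,
      HarmonicKnot.knotType_harmonic_reflect hab hac hbc⟩
  · rw [show a * b + a - b = -(-1) * a + (a - 1) * b by ring,
      show a * b - a - b = (-1) * a + (a - 1) * b by ring]
    refine HarmonicKnot.knotType_harmonic_reflect hab ?_ ?_
    · rw [show -1 * a + (a - 1) * b = -b + a * (b - 1) by ring]
      exact hab.neg_right.add_mul_left_right _
    · rw [show -1 * a + (a - 1) * b = -a + b * (a - 1) by ring]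
      exact hab.symm.neg_right.add_mul_left_right _
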